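/- A strict partition is a finite strictly decreasing sequence of positive integers $\bar\lambda=(\bar\lambda_1>\bar\lambda_2>\cdots>\bar\lambda_\ell>0)$ (possibly empty). Its shifted Young diagram consists of the boxes $(i,j)$ (row $i$, column $j$) with $1\le i\le\ell$ and $i+1\le j\le i+\bar\lambda_i$. The doubled distinct partition $\bar\lambda\bar\lambda$ is the partition whose Young diagram is obtained from the shifted Young diagram by adding $\bar\lambda_i$ boxes to the $i$-th column for $1\le i\le\ell$ (that is, the boxes $(i,i),(i+1,i),\dots,(i+\bar\lambda_i-1,i)$); it has size $|\bar\lambda\bar\lambda|=2\sum_i\bar\lambda_i$. For a partition $\lambda$, let $H(\lambda)$ be the product of the hook lengths of all boxes of its Young diagram, and let $\mathcal C(\lambda)$ be the multiset of the contents $j-i$ of its boxes $(i,j)$. For finite multisets $A,B$ of numbers and a partition $\delta=(\delta_1,\dots,\delta_r)$ put $$\Psi^k(A,B)=\sum_{a\in A}a^k-\sum_{b\in B}b^k,\qquad \Psi^\delta(A,B)=\prod_{j=1}^{r}\Psi^{\delta_j}(A,B).$$ **Theorem.** For each partition $\delta$ there is a polynomial $P\in\mathbb Q[x]$ such that for all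 integers $n\ge 0$ $$2^n\, n!\sum_{|\bar\lambda\bar\lambda|=2n}\frac{\Psi^\delta(\mathcal C(\bar\lambda\bar\lambda),\emptyset)}{H(\bar\lambda\bar\lambda)}=P(n),$$ where the sum is over all strict partitions $\bar\lambda$ with $|\bar\lambda\bar\lambda|=2n$. -/

import Mathlib

open scoped Nat

/-- A strict partition: a finite strictly decreasing sequence of positive integers. -/
structure StrictPartition where
  /-- The parts, in decreasing order. -/
  parts : List ℕ
  sorted : parts.SortedGT
  pos : ∀ p ∈ parts, 0 < p

namespace StrictPartition

@[ext]
theorem ext' {p q : StrictPartition} (h : p.parts = q.parts) : p = q := by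
  cases p; cases q; cases h; rfl

/-- The number of parts. -/
def length (p : StrictPartition) : ℕ := p.parts.length

/-- The part with index `i`, counted from `0`; it is `0` if `i` is at least the length. -/
def part (p : StrictPartition) (i : ℕ) : ℕ := p.parts.getD i 0

/-- The boxes of the shifted Young diagram, as pairs (row, column), both counted from `0`:
the row `i` consists of the boxes `(i, i + 1), …, (i, i + part i)`. -/
def shiftedCells (p : StrictPartition) : Finset (ℕ × ℕ) :=
  (Finset.range p.length).biUnion fun i =>
    (Finset.range (p.part i)).image fun k => (i, i + 1 + k)

/-- The boxes added to the shifted Young diagram to obtain the doubled distinct partition: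
`part j` boxes at the bottom of the column `j`, for each index `j` of a part. The shifted diagram
occupies the rows `0, …, j - 1` of that column, so the new boxes are in the rows
`j, …, j + part j - 1`. -/
def addedCells (p : StrictPartition) : Finset (ℕ × ℕ) :=
  (Finset.range p.length).biUnion fun j =>
    (Finset.range (p.part j)).image fun k => (j + k, j)

theorem lt_length_of_part_pos (p : StrictPartition) {i : ℕ} (h : 0 < p.part i) :
    i < p.length := by
  by_contra hi
  simp only [part, length, not_lt] at *
  rw [List.getD_eq_default _ _ hi] at h
  omega

theorem part_succ_le (p : StrictPartition) (i : ℕ) (h : 0 < p.part (i + 1)) :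
    p.part (i + 1) + 1 ≤ p.part i := by
  have hi : i + 1 < p.parts.length := p.lt_length_of_part_pos h
  have hi' : i < p.parts.length := by omega
  have := List.pairwise_iff_getElem.1 p.sorted.pairwise i (i + 1) hi' hi (Nat.lt_succ_self i)
  simp only [part, List.getD_eq_getElem _ _ hi, List.getD_eq_getElem _ _ hi']
  omega

theorem add_part_le (p : StrictPartition) {a b : ℕ} (hab : a ≤ b) (h : 0 < p.part b) :
    b + p.part b ≤ a + p.part a := by
  induction b, hab using Nat.le_induction with
  | base => exact le_rfl
  | succ b _ ih =>
    have h1 := p.part_succ_le b h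
    have h2 := ih (by omega)
    omega

theorem mem_union (p : StrictPartition) (i j : ℕ) :
    (i, j) ∈ p.shiftedCells ∪ p.addedCells ↔
      (i < j ∧ j ≤ i + p.part i) ∨ (j ≤ i ∧ i < j + p.part j) := by
  simp only [shiftedCells, addedCells, Finset.mem_union, Finset.mem_biUnion, Finset.mem_range,
    Finset.mem_image, Prod.mk.injEq]
  constructor
  · rintro (⟨a, _, k, hk, rfl, rfl⟩ | ⟨a, _, k, hk, rfl, rfl⟩)
    · left; omega
    · right; omega
  · rintro (⟨h1, h2⟩ | ⟨h1, h2⟩)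
    · exact Or.inl ⟨i, p.lt_length_of_part_pos (by omega), j - i - 1, by omega, rfl, by omega⟩
    · exact Or.inr ⟨j, p.lt_length_of_part_pos (by omega), i - j, by omega, by omega, rfl⟩

/-- The doubled distinct partition of a strict partition, as a Young diagram. -/
def doubled (p : StrictPartition) : YoungDiagram where
  cells := p.shiftedCells ∪ p.addedCells
  isLowerSet := by
    rintro ⟨i, j⟩ ⟨i', j'⟩ hle hmem
    obtain ⟨hi, hj⟩ : i' ≤ i ∧ j' ≤ j := hle
    rw [Finset.mem_coe, mem_union] at hmem ⊢
    rcases hmem with ⟨h1, h2⟩ | ⟨h1, h2⟩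
    · rcases lt_or_ge i' j' with h | h
      · have := p.add_part_le hi (by omega)
        left; omega
      · have := p.add_part_le (show j' ≤ i by omega) (by omega)
        right; omega
    · rcases lt_or_ge i' j' with h | h
      · have := p.add_part_le (show i' ≤ j by omega) (by omega)
        left; omega
      · have := p.add_part_le hj (by omega)
        right; omega

theorem part_le_card (p : StrictPartition) (i : ℕ) (hi : i < p.length) :
    p.part i ≤ p.doubled.card := by
  have h : ((Finset.range (p.part i)).image fun k => (i, i + 1 + k)).card = p.part i := by
    rw [Finset.card_image_of_injective _ (fun a b h => by simpa using h), Finset.card_range]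
  rw [← h]
  refine Finset.card_le_card (Finset.Subset.trans ?_ Finset.subset_union_left)
  exact Finset.subset_biUnion_of_mem
    (fun i => (Finset.range (p.part i)).image fun k => (i, i + 1 + k)) (Finset.mem_range.2 hi)

theorem finite_doubled_card_eq (N : ℕ) : {p : StrictPartition | p.doubled.card = N}.Finite := by
  refine Set.Finite.of_finite_image (f := fun p => p.parts.toFinset) ?_ ?_
  · refine (Finset.finite_toSet (Finset.range (N + 1)).powerset).subset ?_
    rintro _ ⟨p, hp, rfl⟩
    simp only [Finset.mem_coe, Finset.mem_powerset]
    intro x hx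
    obtain ⟨i, hi, rfl⟩ := List.getElem_of_mem (List.mem_toFinset.1 hx)
    have := p.part_le_card i hi
    simp only [part, List.getD_eq_getElem _ _ hi] at this
    rw [Set.mem_ofPred_eq] at hp
    rw [Finset.mem_range]
    omega
  · intro p _ q _ h
    apply StrictPartition.ext'
    have hp : p.parts.Nodup := p.sorted.pairwise.imp (fun h => (ne_of_gt h))
    have hq : q.parts.Nodup := q.sorted.pairwise.imp (fun h => (ne_of_gt h))
    exact List.Perm.eq_of_pairwise (fun a b _ _ h1 h2 => absurd h1 (lt_asymm h2))
      p.sorted.pairwise q.sorted.pairwise (List.perm_of_nodup_nodup_toFinset_eq hp hq h)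

/-- The finite set of all strict partitions whose doubled distinct partition has size `N`. -/
noncomputable def withDoubledSize (N : ℕ) : Finset StrictPartition :=
  (finite_doubled_card_eq N).toFinset

theorem mem_withDoubledSize {N : ℕ} {p : StrictPartition} :
    p ∈ withDoubledSize N ↔ p.doubled.card = N := by
  simp [withDoubledSize]

end StrictPartition

namespace YoungDiagram

/-- The hook length of the box `(i, j)`: the number of boxes strictly to the right in the same
row, plus the number of boxes strictly below in the same column, plus one for the box itself. -/
def hookLen (μ : YoungDiagram) (i j : ℕ) : ℕ :=
  (μ.rowLen i - (j + 1)) + (μ.colLen j - (i + 1)) + 1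

/-- The product of all hook lengths. -/
def hookProd (μ : YoungDiagram) : ℕ := ∏ c ∈ μ.cells, μ.hookLen c.1 c.2

/-- The multiset of contents: the box in row `i` and column `j` has content `j - i`. -/
def contents (μ : YoungDiagram) : Multiset ℤ := μ.cells.val.map fun c => (c.2 : ℤ) - (c.1 : ℤ)

end YoungDiagram

/-- The power sum of degree `k` of the difference `A - B` of two finite alphabets. -/
def psiPow (k : ℕ) (A B : Multiset ℚ) : ℚ := (A.map (· ^ k)).sum - (B.map (· ^ k)).sum

/-- The product of the power sums of `A - B` whose degrees are the parts of the partition `ν`. -/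
def psiPartition {m : ℕ} (ν : Nat.Partition m) (A B : Multiset ℚ) : ℚ :=
  (ν.parts.map fun k => psiPow k A B).prod

/-!
A strict partition is encoded by its set of parts `S`, a finite set of positive integers. The
numbers `2 ^ n * n! / H` are the shifted Plancherel measure on the strict partitions of `n`, where
`H` is the hook product of the doubled diagram, and the assertion is that the expectation of a
product of power sums of contents is a polynomial in `n`.

The measures are the marginals of a growth process that appends one box at a time
(`PartSet.mean_succ`). This follows from a detailed balance between explicit up- and down-weights
(`PartSet.weight_addBox_mul_downWeight`) and from the sum of the down-weights
(`PartSet.sum_downWeight`). A box of content `c` is described by `u = c (c - 1)`. With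
`lo x = x (x - 1)` and `hi x = x (x + 1)`, the up-weight at the row of length `x` is the residue at
`u = hi x` of the rational function `∏ (u - lo j) / (u ∏ (u - hi j))`, where `j` runs over `S`.
Hence the `k`-th moment of `u` for the appended box is the `k`-th coefficient of the expansion of
`∏ (1 - lo j / u) / (1 - hi j / u)` at infinity, which is a polynomial in the power sums
`∑ (hi j ^ m - lo j ^ m)` with `m ≤ k` (`succ_mul_sum_residue_pow`).

Contents of the doubled diagram come in pairs `c`, `1 - c`, and `c ^ k + (1 - c) ^ k` is a
polynomial in `u`. Therefore power sums of contents lie in the algebra generated by the sums of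
`u ^ d` over the boxes of the shifted diagram, and so do the power sums above, in degree `m` if the
`d`-th generator has degree `d + 1` (`PartSet.filtered_sum_hi_pow_sub_lo_pow`). Appending a box
adds `u ^ d` to that generator, and the average of `u ^ k` over the appended box has degree at most
`k`; so the drift of the growth process lowers the degree. By induction on the degree, the
expectation of each element of the algebra has polynomial differences in `n`, and so is a
polynomial (`PartSet.Filtered.exists_mean_eq_eval`).

The weight `PartSet.weight` is identified with `1 / H` by computing the hook lengths of the doubled
diagram: those in the diagonal square are the sums of two parts, and those to the right of it and
below it are given, row by row and column by column, by the classical argument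
`prod_hook_mul_prod_sub`.
-/

/-! ### Residue sums of a rational function -/

/-- The sum of the residues of `∏ (z - b j) / ∏ (z - a j)` at its poles, read off from the
expansion at infinity. -/
theorem sum_residue_eq {ι F : Type*} [DecidableEq ι] [Field F] (s : Finset ι) (a b : ι → F)
    (ha : Set.InjOn a s) :
    ∑ i ∈ s, (∏ j ∈ s, (a i - b j)) / ∏ j ∈ s.erase i, (a i - a j) =
      ∑ i ∈ s, (a i - b i) := by
  rcases s.eq_empty_or_nonempty with rfl | hs
  · simp
  have hdeg : (Lagrange.nodal s b - Lagrange.nodal s a).degree < s.card := by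
    have h := Polynomial.degree_sub_lt_left (p := Lagrange.nodal s b) (q := Lagrange.nodal s a)
      (by rw [Lagrange.degree_nodal, Lagrange.degree_nodal]) Lagrange.nodal_ne_zero
      (by rw [Lagrange.nodal_monic.leadingCoeff, Lagrange.nodal_monic.leadingCoeff])
    rwa [Lagrange.degree_nodal] at h
  have h := Lagrange.coeff_eq_sum ha hdeg
  rw [Polynomial.coeff_sub, Lagrange.nodal_eq, Lagrange.nodal_eq,
    Polynomial.prod_X_sub_C_coeff_card_pred s b hs.card_pos,
    Polynomial.prod_X_sub_C_coeff_card_pred s a hs.card_pos] at h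
  rw [Finset.sum_sub_distrib, ← neg_add_eq_sub, ← sub_neg_eq_add, h]
  refine Finset.sum_congr rfl fun i hi => ?_
  rw [← Lagrange.nodal_eq, ← Lagrange.nodal_eq, Polynomial.eval_sub, Lagrange.eval_nodal,
    Lagrange.eval_nodal_at_node hi, sub_zero]

/-- The partial fraction expansion of `∏ (z - a j) / ∏ (z - v l)`, with one more factor in the
denominator than in the numerator, cleared of denominators and written in the variable `1 / z`. -/
theorem prod_one_sub_eq_sum {ι : Type*} [DecidableEq ι] (s t : Finset ι) (a v : ι → ℚ)
    (hv : Set.InjOn v t) (hcard : t.card = s.card + 1) :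
    ∏ j ∈ s, (1 - Polynomial.C (a j) * Polynomial.X) =
      ∑ i ∈ t, Polynomial.C ((∏ j ∈ s, (v i - a j)) / ∏ l ∈ t.erase i, (v i - v l)) *
        ∏ l ∈ t.erase i, (1 - Polynomial.C (v l) * Polynomial.X) := by
  refine Polynomial.eq_of_infinite_eval_eq _ _
    ((Set.finite_singleton (0 : ℚ)).infinite_compl.mono fun x hx => ?_)
  have hx : x ≠ 0 := hx
  have hdeg : (Lagrange.nodal s a).degree < t.card := by
    rw [Lagrange.degree_nodal, hcard]
    exact_mod_cast Nat.lt_succ_self _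
  have h := congrArg (Polynomial.eval x⁻¹) (Lagrange.eq_interpolate hv hdeg)
  rw [Lagrange.interpolate_apply, Polynomial.eval_finsetSum, Lagrange.eval_nodal] at h
  have key : ∀ (u : Finset ι) (w : ι → ℚ),
      ∏ j ∈ u, (1 - w j * x) = x ^ u.card * ∏ j ∈ u, (x⁻¹ - w j) := by
    intro u w
    rw [← Finset.prod_const, ← Finset.prod_mul_distrib]
    refine Finset.prod_congr rfl fun j _ => ?_
    field_simp
  rw [Set.mem_ofPred_eq, Polynomial.eval_prod, Polynomial.eval_finsetSum]
  simp only [Polynomial.eval_sub, Polynomial.eval_one, Polynomial.eval_mul, Polynomial.eval_C,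
    Polynomial.eval_X, Polynomial.eval_prod]
  rw [key, h, Finset.mul_sum]
  refine Finset.sum_congr rfl fun i hi => ?_
  rw [key, Finset.card_erase_of_mem hi, hcard, Nat.add_sub_cancel, Polynomial.eval_mul,
    Polynomial.eval_C, Lagrange.eval_nodal, Lagrange.basis, Polynomial.eval_prod]
  simp only [Lagrange.basisDivisor, Polynomial.eval_mul, Polynomial.eval_C, Polynomial.eval_sub,
    Polynomial.eval_X, Finset.prod_mul_distrib, Finset.prod_inv_distrib]
  ring

theorem sum_residue_eq_one {ι : Type*} [DecidableEq ι] (s t : Finset ι) (a v : ι → ℚ)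
    (hv : Set.InjOn v t) (hcard : t.card = s.card + 1) :
    ∑ i ∈ t, (∏ j ∈ s, (v i - a j)) / ∏ l ∈ t.erase i, (v i - v l) = 1 := by
  have h := congrArg (Polynomial.eval 0) (prod_one_sub_eq_sum s t a v hv hcard)
  simpa [Polynomial.eval_prod, Polynomial.eval_finsetSum] using h.symm

theorem one_sub_mul_geometric (c : ℚ) :
    (1 - PowerSeries.C c * PowerSeries.X) * PowerSeries.mk (fun n => c ^ n) = 1 := by
  ext n
  rw [sub_mul, one_mul, mul_assoc, map_sub, PowerSeries.coeff_mk, PowerSeries.coeff_C_mul]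
  cases n with
  | zero => simp
  | succ n =>
    rw [PowerSeries.coeff_succ_X_mul, PowerSeries.coeff_mk, PowerSeries.coeff_one]
    simp [pow_succ']

/-- The logarithmic derivative of `∏ (1 - a j X)` is minus the generating function of the power
sums. -/
theorem derivative_prod_one_sub {ι : Type*} [DecidableEq ι] (s : Finset ι) (a : ι → ℚ) :
    PowerSeries.derivative ℚ (∏ j ∈ s, (1 - PowerSeries.C (a j) * PowerSeries.X)) =
      -((∏ j ∈ s, (1 - PowerSeries.C (a j) * PowerSeries.X)) *
        PowerSeries.mk fun n => ∑ j ∈ s, a j ^ (n + 1)) := by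
  induction s using Finset.induction_on with
  | empty =>
    have : (PowerSeries.mk fun _ => (0 : ℚ)) = 0 := by ext; simp
    simp [this]
  | insert i s hi ih =>
    have hd : PowerSeries.derivative ℚ (1 - PowerSeries.C (a i) * PowerSeries.X) =
        -PowerSeries.C (a i) := by
      simp [Derivation.leibniz]
    have hmk : (PowerSeries.mk fun n => ∑ j ∈ insert i s, a j ^ (n + 1)) =
        PowerSeries.C (a i) * PowerSeries.mk (fun n => a i ^ n) +
          PowerSeries.mk fun n => ∑ j ∈ s, a j ^ (n + 1) := by
      ext n
      simp [Finset.sum_insert hi, pow_succ']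
    rw [Finset.prod_insert hi, Derivation.leibniz, ih, hd, hmk, smul_eq_mul, smul_eq_mul]
    linear_combination (PowerSeries.C (a i) *
      ∏ j ∈ s, (1 - PowerSeries.C (a j) * PowerSeries.X)) * one_sub_mul_geometric (a i)

/-- Newton's recursion for the moments of the residues of `∏ (z - a j) / ∏ (z - v l)`: they are the
complete symmetric functions of the difference of the alphabets `v` and `a`, so that power sums of
that difference express them. -/
theorem succ_mul_sum_residue_pow {ι : Type*} [DecidableEq ι] (s t : Finset ι) (a v : ι → ℚ)
    (hv : Set.InjOn v t) (hcard : t.card = s.card + 1) (n : ℕ) (p : ι → ℚ)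
    (hp : ∀ i ∈ t, p i = (∏ j ∈ s, (v i - a j)) / ∏ l ∈ t.erase i, (v i - v l)) :
    (n + 1) * ∑ i ∈ t, p i * v i ^ (n + 1) =
      ∑ m ∈ Finset.HasAntidiagonal.antidiagonal n, (∑ i ∈ t, p i * v i ^ m.1) *
        (∑ i ∈ t, v i ^ (m.2 + 1) - ∑ j ∈ s, a j ^ (m.2 + 1)) := by
  set P : PowerSeries ℚ := ∏ j ∈ s, (1 - PowerSeries.C (a j) * PowerSeries.X) with hP
  set Q : PowerSeries ℚ := ∏ l ∈ t, (1 - PowerSeries.C (v l) * PowerSeries.X) with hQ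
  set G : PowerSeries ℚ := PowerSeries.mk fun n => ∑ i ∈ t, p i * v i ^ n with hG
  have hGsum : G = ∑ i ∈ t, PowerSeries.C (p i) * PowerSeries.mk fun n => v i ^ n := by
    ext n
    simp [hG]
  have hGQ : G * Q = P := by
    have h := congrArg (Polynomial.toPowerSeries) (prod_one_sub_eq_sum s t a v hv hcard)
    have hcoe : ∀ (u : Finset ι) (w : ι → ℚ),
        ((∏ j ∈ u, (1 - Polynomial.C (w j) * Polynomial.X) : Polynomial ℚ) : PowerSeries ℚ) =
          ∏ j ∈ u, (1 - PowerSeries.C (w j) * PowerSeries.X) := by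
      intro u w
      rw [← Polynomial.coeToPowerSeries.ringHom_apply, map_prod]
      simp
    rw [hcoe] at h
    rw [hP, h, ← Polynomial.coeToPowerSeries.ringHom_apply, map_sum, hGsum, Finset.sum_mul]
    refine Finset.sum_congr rfl fun i hi => ?_
    rw [map_mul, Polynomial.coeToPowerSeries.ringHom_apply,
      Polynomial.coeToPowerSeries.ringHom_apply, hcoe, Polynomial.coe_C, ← hp i hi, hQ,
      ← Finset.mul_prod_erase t _ hi]
    linear_combination (PowerSeries.C (p i) *
      ∏ l ∈ t.erase i, (1 - PowerSeries.C (v l) * PowerSeries.X)) * one_sub_mul_geometric (v i)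
  have hQ0 : Q ≠ 0 := by
    rw [hQ, Finset.prod_ne_zero_iff]
    intro l _ h
    have := one_sub_mul_geometric (v l)
    rw [h, zero_mul] at this
    exact zero_ne_one this
  have hD : PowerSeries.derivative ℚ G = G * ((PowerSeries.mk fun n => ∑ i ∈ t, v i ^ (n + 1)) -
      PowerSeries.mk fun n => ∑ j ∈ s, a j ^ (n + 1)) := by
    have h := congrArg (PowerSeries.derivative ℚ) hGQ
    rw [Derivation.leibniz, hP, hQ, derivative_prod_one_sub, derivative_prod_one_sub, ← hP, ← hQ,
      smul_eq_mul, smul_eq_mul] at h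
    refine mul_left_cancel₀ hQ0 ?_
    linear_combination h + (PowerSeries.mk fun n => ∑ j ∈ s, a j ^ (n + 1)) * hGQ
  have h := congrArg (PowerSeries.coeff n) hD
  rw [PowerSeries.coeff_derivative, PowerSeries.coeff_mul] at h
  simp only [hG, map_sub, PowerSeries.coeff_mk] at h
  rw [mul_comm]
  exact h

/-! ### The growth process on sets of parts -/

namespace PartSet

/-- The value of `c (c - 1)` at the content `c = x` of the last box of a row of length `x` in a
shifted diagram. -/
def lo (x : ℕ) : ℚ := x * (x - 1)

/-- The value of `c (c - 1)` at the content `c = x + 1` of the box that can be appended to a row of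
length `x` in a shifted diagram. -/
def hi (x : ℕ) : ℚ := x * (x + 1)

/-- The set of parts after a box is appended to the row of length `x`; for `x = 0` a new row of
length one is created. -/
def addBox (S : Finset ℕ) (x : ℕ) : Finset ℕ := insert (x + 1) (S.erase x)

/-- The probability to append a box to the row of length `x`, where `x ∈ insert 0 S`. It is zero
if the result is not a strict partition. -/
def upProb (S : Finset ℕ) (x : ℕ) : ℚ :=
  (∏ j ∈ S, (hi x - lo j)) / ∏ l ∈ (insert 0 S).erase x, (hi x - hi l)

/-- Twice the ratio of the shifted hook product of `S` to that of `S` with a box removed from the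
row of length `y`. It is zero if the result is not a strict partition. -/
def downWeight (S : Finset ℕ) (y : ℕ) : ℚ :=
  -((∏ j ∈ S, (lo y - hi j)) / ∏ l ∈ S.erase y, (lo y - lo l))

/-- The factor of the weight belonging to a pair of parts; it is one on the diagonal, so that
products may run over all pairs. -/
def pairFactor (x y : ℕ) : ℚ := if x = y then 1 else |(x : ℚ) - y| / (x + y)

/-- The inverse of the hook product of the doubled distinct partition with set of parts `S`. -/
def weight (S : Finset ℕ) : ℚ :=
  (∏ x ∈ S, 1 / (2 * (x ! : ℚ) ^ 2)) * ∏ x ∈ S, ∏ y ∈ S, pairFactor x y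

theorem lo_succ (x : ℕ) : lo (x + 1) = hi x := by
  simp only [lo, hi]; push_cast; ring

theorem hi_zero : hi 0 = 0 := by simp [hi]

theorem hi_injective : Function.Injective hi := by
  intro x y h
  simp only [hi] at h
  have h' : ((x : ℚ) - y) * (x + y + 1) = 0 := by linear_combination h
  rcases mul_eq_zero.1 h' with h | h
  · exact_mod_cast sub_eq_zero.1 h
  · exact absurd h (by positivity)

theorem lo_injOn {S : Finset ℕ} (hS : 0 ∉ S) : Set.InjOn lo S := by
  have key : ∀ x ∈ S, ∃ z, x = z + 1 := fun x hx =>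
    Nat.exists_eq_succ_of_ne_zero fun h => hS (h ▸ hx)
  intro x hx y hy h
  obtain ⟨x, rfl⟩ := key x hx
  obtain ⟨y, rfl⟩ := key y hy
  rw [lo_succ, lo_succ] at h
  rw [hi_injective h]

theorem hi_sub_lo (x : ℕ) : hi x - lo x = 2 * x := by
  simp only [lo, hi]; ring

theorem sum_downWeight {S : Finset ℕ} (hS : 0 ∉ S) :
    ∑ y ∈ S, downWeight S y = 2 * ((∑ x ∈ S, x : ℕ) : ℚ) := by
  simp only [downWeight]
  rw [Finset.sum_neg_distrib, sum_residue_eq S lo hi (lo_injOn hS), ← Finset.sum_neg_distrib,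
    Nat.cast_sum, Finset.mul_sum]
  refine Finset.sum_congr rfl fun x _ => ?_
  rw [neg_sub, hi_sub_lo]

theorem upProb_eq_zero {S : Finset ℕ} {x : ℕ} (h : x + 1 ∈ S) : upProb S x = 0 := by
  rw [upProb, Finset.prod_eq_zero h (by rw [lo_succ, sub_self]), zero_div]

theorem downWeight_eq_zero {S : Finset ℕ} {y : ℕ} (hy : y ≠ 0) (h : y - 1 ∈ S) :
    downWeight S y = 0 := by
  obtain ⟨x, rfl⟩ := Nat.exists_eq_succ_of_ne_zero hy
  rw [downWeight, Finset.prod_eq_zero h (by rw [lo_succ]; exact sub_self _), zero_div, neg_zero]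

theorem pairFactor_comm (x y : ℕ) : pairFactor x y = pairFactor y x := by
  simp only [pairFactor, eq_comm (a := x) (b := y), abs_sub_comm (x : ℚ) y, add_comm (x : ℚ) y]

theorem weight_insert {C : Finset ℕ} {z : ℕ} (hz : z ∉ C) :
    weight (insert z C) = 1 / (2 * (z ! : ℚ) ^ 2) * (∏ j ∈ C, pairFactor z j ^ 2) * weight C := by
  have h1 : ∏ x ∈ C, ∏ y ∈ insert z C, pairFactor x y =
      (∏ j ∈ C, pairFactor z j) * ∏ x ∈ C, ∏ y ∈ C, pairFactor x y := by
    rw [← Finset.prod_mul_distrib]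
    exact Finset.prod_congr rfl fun x _ => by rw [Finset.prod_insert hz, pairFactor_comm]
  rw [weight, weight, Finset.prod_insert hz, Finset.prod_insert hz, Finset.prod_insert hz, h1,
    Finset.prod_pow]
  have : pairFactor z z = 1 := if_pos rfl
  rw [this]
  ring

theorem pairFactor_sq {x y : ℕ} (h : y ≠ x) :
    pairFactor x y ^ 2 = (((x : ℚ) - y) / (x + y)) ^ 2 := by
  rw [pairFactor, if_neg (Ne.symm h), div_pow, div_pow, sq_abs]

/-- The contribution of a part `j` to the detailed balance of `weight_addBox_mul_downWeight`. -/
theorem pairFactor_balance {x j : ℕ} (h0 : j ≠ 0) (h1 : j ≠ x) (h2 : j ≠ x + 1) :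
    pairFactor (x + 1) j ^ 2 * ((hi x - hi j) / (hi x - lo j)) =
      (((x : ℚ) - j) / (x + j)) ^ 2 * ((hi x - lo j) / (hi x - hi j)) := by
  have e1 : hi x - hi j = ((x : ℚ) - j) * (x + j + 1) := by simp only [hi]; ring
  have e2 : hi x - lo j = ((x : ℚ) + 1 - j) * (x + j) := by simp only [hi, lo]; ring
  have hj : (0 : ℚ) < j := by exact_mod_cast Nat.pos_of_ne_zero h0
  have n1 : (x : ℚ) - j ≠ 0 := sub_ne_zero.2 (by exact_mod_cast h1.symm)
  have n2 : (x : ℚ) + 1 - j ≠ 0 := sub_ne_zero.2 (by exact_mod_cast h2.symm)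
  have n3 : (x : ℚ) + j ≠ 0 := by positivity
  have n4 : (x : ℚ) + j + 1 ≠ 0 := by positivity
  have n5 : (x : ℚ) + 1 + j ≠ 0 := by positivity
  rw [pairFactor_sq h2, e1, e2]
  push_cast
  field_simp
  ring

/-- Detailed balance: appending a box, with the up-probabilities, and removing it, with the
down-weights, are adjoint with respect to the weight. -/
theorem weight_addBox_mul_downWeight {S : Finset ℕ} {x : ℕ} (hS : 0 ∉ S) (hx : x ∈ insert 0 S)
    (hx1 : x + 1 ∉ S) :
    weight (addBox S x) * downWeight (addBox S x) (x + 1) = weight S * upProb S x := by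
  set C := S.erase x with hC
  have hxC : x ∉ C := Finset.notMem_erase x S
  have h1C : x + 1 ∉ C := fun h => hx1 (Finset.mem_of_mem_erase h)
  have h0C : 0 ∉ C := fun h => hS (Finset.mem_of_mem_erase h)
  have hdown : downWeight (addBox S x) (x + 1) =
      2 * (x + 1) * ∏ j ∈ C, ((hi x - hi j) / (hi x - lo j)) := by
    rw [downWeight, addBox, Finset.prod_insert h1C, Finset.erase_insert h1C, lo_succ,
      Finset.prod_div_distrib, ← lo_succ, ← neg_sub (hi (x + 1)), hi_sub_lo]
    push_cast
    ring
  have hbal : (∏ j ∈ C, pairFactor (x + 1) j ^ 2) * ∏ j ∈ C, ((hi x - hi j) / (hi x - lo j)) =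
      (∏ j ∈ C, (((x : ℚ) - j) / (x + j)) ^ 2) *
        ∏ j ∈ C, ((hi x - lo j) / (hi x - hi j)) := by
    rw [← Finset.prod_mul_distrib, ← Finset.prod_mul_distrib]
    exact Finset.prod_congr rfl fun j hj => pairFactor_balance (fun h => h0C (h ▸ hj))
      (fun h => hxC (h ▸ hj)) (fun h => h1C (h ▸ hj))
  have hfac : (((x + 1)! : ℕ) : ℚ) = (x + 1) * (x ! : ℚ) := by
    rw [Nat.factorial_succ]; push_cast; ring
  have hf0 : (x ! : ℚ) ≠ 0 := by exact_mod_cast Nat.factorial_ne_zero x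
  have hx10 : (x : ℚ) + 1 ≠ 0 := by positivity
  rw [hdown, addBox, weight_insert h1C, hfac]
  rcases Nat.eq_zero_or_pos x with rfl | hpos
  · have hSC : S = C := (Finset.erase_eq_of_notMem hS).symm
    have hone : ∏ j ∈ C, ((((0 : ℕ) : ℚ) - j) / ((0 : ℕ) + j)) ^ 2 = 1 := by
      refine Finset.prod_eq_one fun j hj => ?_
      have : (j : ℚ) ≠ 0 := by
        intro h
        rw [Nat.cast_eq_zero] at h
        exact h0C (h ▸ hj)
      push_cast
      field_simp
      ring
    rw [hone] at hbal
    have hup : upProb S 0 = ∏ j ∈ C, ((hi 0 - lo j) / (hi 0 - hi j)) := by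
      rw [upProb, Finset.erase_insert hS, hSC, Finset.prod_div_distrib]
    rw [hup, hSC]
    simp only [Nat.cast_zero, Nat.factorial_zero, Nat.cast_one]
    linear_combination weight C * hbal
  · have hxS : x ∈ S := (Finset.mem_insert.1 hx).resolve_left hpos.ne'
    have hSC : S = insert x C := (Finset.insert_erase hxS).symm
    have hsq : ∏ j ∈ C, (((x : ℚ) - j) / (x + j)) ^ 2 = ∏ j ∈ C, pairFactor x j ^ 2 :=
      Finset.prod_congr rfl fun j hj => by rw [pairFactor_sq (ne_of_mem_of_not_mem hj hxC)]
    have hxq : (x : ℚ) ≠ 0 := by exact_mod_cast hpos.ne'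
    have hup : upProb S x = 2 / (x + 1) * ∏ j ∈ C, ((hi x - lo j) / (hi x - hi j)) := by
      have he : (insert 0 S).erase x = insert 0 C := by
        rw [Finset.erase_insert_of_ne hpos.ne, hC]
      rw [upProb, he, Finset.prod_insert h0C, hSC, Finset.prod_insert hxC, hi_sub_lo, hi_zero,
        Finset.prod_div_distrib, sub_zero, mul_div_mul_comm]
      congr 1
      rw [hi]
      field_simp
    rw [hsq] at hbal
    rw [hup, hSC, weight_insert hxC]
    calc _ = 1 / ((x + 1) * (x ! : ℚ) ^ 2) * weight C * ((∏ j ∈ C, pairFactor (x + 1) j ^ 2) *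
            ∏ j ∈ C, ((hi x - hi j) / (hi x - lo j))) := by field_simp
      _ = _ := by rw [hbal]; field_simp

/-- The sets of parts of the strict partitions of `n`. -/
def ofSize (n : ℕ) : Finset (Finset ℕ) :=
  (Finset.Icc 1 n).powerset.filter fun S => ∑ x ∈ S, x = n

theorem mem_ofSize {n : ℕ} {S : Finset ℕ} : S ∈ ofSize n ↔ 0 ∉ S ∧ ∑ x ∈ S, x = n := by
  rw [ofSize, Finset.mem_filter, Finset.mem_powerset]
  refine and_congr_left fun h => ⟨fun hs h0 => by simpa using hs h0, fun h0 x hx => ?_⟩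
  rw [Finset.mem_Icc, ← h]
  exact ⟨Nat.pos_of_ne_zero fun hx0 => h0 (hx0 ▸ hx),
    Finset.single_le_sum (f := fun x => x) (fun _ _ => Nat.zero_le _) hx⟩

/-- The expectation of `g` with respect to the shifted Plancherel measure on the strict partitions
of `n`. -/
def mean (n : ℕ) (g : Finset ℕ → ℚ) : ℚ := 2 ^ n * (n ! : ℚ) * ∑ S ∈ ofSize n, weight S * g S

theorem zero_notMem_addBox {S : Finset ℕ} (hS : 0 ∉ S) (x : ℕ) : 0 ∉ addBox S x := by
  rw [addBox, Finset.mem_insert, not_or]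
  exact ⟨(Nat.succ_ne_zero x).symm, fun h => hS (Finset.mem_of_mem_erase h)⟩

/-- Appending a box changes only one summand of a sum over the parts. -/
theorem sum_addBox {S : Finset ℕ} {M : Type*} [AddCommGroup M] (hS : 0 ∉ S) {x : ℕ}
    (hx : x ∈ insert 0 S) (hx1 : x + 1 ∉ S) (f : ℕ → M) (hf : f 0 = 0) :
    ∑ y ∈ addBox S x, f y = ∑ y ∈ S, f y + (f (x + 1) - f x) := by
  rw [addBox, Finset.sum_insert fun h => hx1 (Finset.mem_of_mem_erase h)]
  rcases Finset.mem_insert.1 hx with rfl | hx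
  · rw [Finset.erase_eq_of_notMem hS, hf]
    abel
  · rw [← Finset.add_sum_erase S f hx]
    abel

theorem addBox_mem_ofSize {n x : ℕ} {S : Finset ℕ} (hS : S ∈ ofSize n) (hx : x ∈ insert 0 S)
    (hx1 : x + 1 ∉ S) : addBox S x ∈ ofSize (n + 1) := by
  rw [mem_ofSize] at hS ⊢
  refine ⟨zero_notMem_addBox hS.1 x, ?_⟩
  have h := sum_addBox hS.1 hx hx1 (fun y => (y : ℤ)) rfl
  rw [← Nat.cast_sum, ← Nat.cast_sum, hS.2] at h
  push_cast at h
  zify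
  rw [← Nat.cast_sum]
  push_cast
  linarith

/-- The shifted Plancherel measures are the marginals of the growth process. -/
theorem mean_succ (n : ℕ) (g : Finset ℕ → ℚ) :
    mean (n + 1) g = mean n fun S => ∑ x ∈ insert 0 S, upProb S x * g (addBox S x) := by
  have hdown : 2 * ((n : ℚ) + 1) * ∑ S ∈ ofSize (n + 1), weight S * g S =
      ∑ S ∈ ofSize (n + 1), ∑ y ∈ S, weight S * downWeight S y * g S := by
    rw [Finset.mul_sum]
    refine Finset.sum_congr rfl fun S hS => ?_
    rw [mem_ofSize] at hS
    rw [← Finset.sum_mul, ← Finset.mul_sum, sum_downWeight hS.1, hS.2]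
    push_cast
    ring
  have hup : ∑ S ∈ ofSize (n + 1), ∑ y ∈ S, weight S * downWeight S y * g S =
      ∑ S ∈ ofSize n, ∑ x ∈ insert 0 S, weight S * upProb S x * g (addBox S x) := by
    rw [Finset.sum_sigma', Finset.sum_sigma']
    -- The terms removed here vanish; on the others, appending and removing a box are inverse.
    rw [← Finset.sum_filter_of_ne (p := fun q : (_ : Finset ℕ) × ℕ => q.2 - 1 ∉ q.1),
      ← Finset.sum_filter_of_ne (s := (ofSize n).sigma _)
        (p := fun q : (_ : Finset ℕ) × ℕ => q.2 + 1 ∉ q.1)]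
    · symm
      refine Finset.sum_bij' (fun q _ => ⟨addBox q.1 q.2, q.2 + 1⟩)
        (fun q _ => ⟨(insert (q.2 - 1) (q.1.erase q.2)).erase 0, q.2 - 1⟩) ?_ ?_ ?_ ?_ ?_
      · rintro ⟨S, x⟩ h
        simp only [Finset.mem_filter, Finset.mem_sigma] at h ⊢
        refine ⟨⟨addBox_mem_ofSize h.1.1 h.1.2 h.2, Finset.mem_insert_self _ _⟩, ?_⟩
        simp [addBox]
      · rintro ⟨S, y⟩ h
        simp only [Finset.mem_filter, Finset.mem_sigma, mem_ofSize] at h ⊢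
        obtain ⟨⟨⟨h0, hsum⟩, hy⟩, hy1⟩ := h
        obtain ⟨x, rfl⟩ := Nat.exists_eq_succ_of_ne_zero (n := y) fun h => h0 (h ▸ hy)
        simp only [Nat.succ_eq_add_one, Nat.add_sub_cancel] at hy1 ⊢
        refine ⟨⟨⟨Finset.notMem_erase _ _, ?_⟩, ?_⟩, ?_⟩
        · have h1 := Finset.add_sum_erase S (fun z => z) hy
          have h2 : ∑ z ∈ (insert x (S.erase (x + 1))).erase 0, z =
              ∑ z ∈ insert x (S.erase (x + 1)), z :=
            Finset.sum_erase _ rfl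
          rw [h2, Finset.sum_insert fun h => hy1 (Finset.mem_of_mem_erase h)]
          simp only [Nat.succ_eq_add_one] at h1
          omega
        · rcases Nat.eq_zero_or_pos x with rfl | hx
          · exact Finset.mem_insert_self _ _
          · simp [hx.ne']
        · simp
      · rintro ⟨S, x⟩ h
        simp only [Finset.mem_filter, Finset.mem_sigma, mem_ofSize] at h
        obtain ⟨⟨⟨h0, hsum⟩, hx⟩, hx1⟩ := h
        simp only [Nat.add_sub_cancel, Sigma.mk.injEq, heq_eq_eq, and_true, addBox]
        rw [Finset.erase_insert fun h => hx1 (Finset.mem_of_mem_erase h)]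
        rcases Finset.mem_insert.1 hx with rfl | hx
        · rw [Finset.erase_eq_of_notMem h0, Finset.erase_insert h0]
        · rw [Finset.insert_erase hx, Finset.erase_eq_of_notMem h0]
      · rintro ⟨S, y⟩ h
        simp only [Finset.mem_filter, Finset.mem_sigma, mem_ofSize] at h
        obtain ⟨⟨⟨h0, hsum⟩, hy⟩, hy1⟩ := h
        obtain ⟨x, rfl⟩ := Nat.exists_eq_succ_of_ne_zero (n := y) fun h => h0 (h ▸ hy)
        simp only [Nat.succ_eq_add_one, Nat.add_sub_cancel] at hy hy1 ⊢
        simp only [Sigma.mk.injEq, heq_eq_eq, and_true, addBox]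
        rw [Finset.erase_right_comm,
          Finset.erase_insert fun h => hy1 (Finset.mem_of_mem_erase h),
          Finset.erase_eq_of_notMem fun h => h0 (Finset.mem_of_mem_erase h),
          Finset.insert_erase hy]
      · rintro ⟨S, x⟩ h
        simp only [Finset.mem_filter, Finset.mem_sigma, mem_ofSize] at h
        obtain ⟨⟨⟨h0, hsum⟩, hx⟩, hx1⟩ := h
        simp only [weight_addBox_mul_downWeight h0 hx hx1]
    · rintro ⟨S, x⟩ _ h hx
      exact h (by simp [upProb_eq_zero hx])
    · rintro ⟨S, y⟩ hm h hy
      rw [Finset.mem_sigma, mem_ofSize] at hm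
      exact h (by simp [downWeight_eq_zero (fun h : y = 0 => hm.1.1 (h ▸ hm.2)) hy])
  rw [mean, mean, Nat.factorial_succ]
  simp only [Finset.mul_sum, ← mul_assoc] at hup hdown ⊢
  rw [hup] at hdown
  push_cast
  simp only [mul_assoc] at hdown ⊢
  simp only [← Finset.mul_sum] at hdown ⊢
  rw [← hdown]
  ring

end PartSet

namespace PartSet

/-! ### Moments of the content of the appended box -/

/-- The moments of `c (c - 1)`, where `c` is the content of the box appended to `S`. -/
def moment (k : ℕ) (S : Finset ℕ) : ℚ := ∑ x ∈ insert 0 S, upProb S x * hi x ^ k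

theorem sum_upProb {S : Finset ℕ} (hS : 0 ∉ S) : ∑ x ∈ insert 0 S, upProb S x = 1 :=
  sum_residue_eq_one S (insert 0 S) lo hi hi_injective.injOn (Finset.card_insert_of_notMem hS)

theorem succ_mul_moment {S : Finset ℕ} (hS : 0 ∉ S) (k : ℕ) :
    (k + 1) * moment (k + 1) S = ∑ m ∈ Finset.HasAntidiagonal.antidiagonal k,
      moment m.1 S * ∑ x ∈ S, (hi x ^ (m.2 + 1) - lo x ^ (m.2 + 1)) := by
  have h := succ_mul_sum_residue_pow S (insert 0 S) lo hi hi_injective.injOn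
    (Finset.card_insert_of_notMem hS) k (upProb S) fun _ _ => rfl
  rw [moment, h]
  refine Finset.sum_congr rfl fun m _ => ?_
  have h0 : ∑ x ∈ insert 0 S, hi x ^ (m.2 + 1) = ∑ x ∈ S, hi x ^ (m.2 + 1) := by
    rw [Finset.sum_insert hS, hi_zero, zero_pow (Nat.succ_ne_zero _), zero_add]
  rw [h0, Finset.sum_sub_distrib, moment]

/-! ### The filtered algebra of content sums -/

/-- The sum of the `d`-th powers of `e (e - 1)` over the contents `e` of the boxes of the shifted
diagram. The contents of a row of length `x` are the numbers `e = c + 1` with `c < x`, for which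
`e (e - 1) = hi c`. -/
def contentSum (d : ℕ) (S : Finset ℕ) : ℚ := ∑ x ∈ S, ∑ c ∈ Finset.range x, hi c ^ d

/-- The filtration by degree of the algebra of functions generated by the content sums, where
`contentSum d` has degree `d + 1`. Functions are identified if they agree on the sets that
consist of positive integers. -/
inductive Filtered : ℕ → (Finset ℕ → ℚ) → Prop
  | const (c : ℚ) : Filtered 0 fun _ => c
  | contentSum (d : ℕ) : Filtered (d + 1) (contentSum d)
  | add {d : ℕ} {f g : Finset ℕ → ℚ} (hf : Filtered d f) (hg : Filtered d g) :
      Filtered d fun S => f S + g S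
  | mul {d e : ℕ} {f g : Finset ℕ → ℚ} (hf : Filtered d f) (hg : Filtered e g) :
      Filtered (d + e) fun S => f S * g S
  | mono {d e : ℕ} {f : Finset ℕ → ℚ} (hde : d ≤ e) (hf : Filtered d f) : Filtered e f
  | congr {d : ℕ} {f g : Finset ℕ → ℚ} (hfg : ∀ S : Finset ℕ, 0 ∉ S → f S = g S)
      (hf : Filtered d f) : Filtered d g

theorem Filtered.const_mul {d : ℕ} {f : Finset ℕ → ℚ} (c : ℚ) (hf : Filtered d f) :
    Filtered d fun S => c * f S :=
  .mono (zero_add d).le (.mul (.const c) hf)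

theorem Filtered.sum {ι : Type*} {d : ℕ} (s : Finset ι) {f : ι → Finset ℕ → ℚ}
    (hf : ∀ i ∈ s, Filtered d (f i)) : Filtered d fun S => ∑ i ∈ s, f i S := by
  classical
  induction s using Finset.induction_on with
  | empty => simpa using Filtered.mono (Nat.zero_le d) (.const 0)
  | insert i s hi ih =>
    refine .congr (fun S _ => (Finset.sum_insert hi).symm) (.add (hf i (Finset.mem_insert_self i s))
      (ih fun j hj => hf j (Finset.mem_insert_of_mem hj)))

theorem filtered_sum_eval (r : Polynomial ℚ) {d : ℕ} (hr : r.natDegree < d) :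
    Filtered d fun S => ∑ x ∈ S, ∑ c ∈ Finset.range x, r.eval (hi c) := by
  refine .congr (f := fun S => ∑ i ∈ Finset.range d, r.coeff i * contentSum i S) (fun S _ => ?_)
    (.sum _ fun i hi => .const_mul _ (.mono (Finset.mem_range.1 hi) (.contentSum i)))
  simp only [contentSum, Finset.mul_sum, Polynomial.eval_eq_sum_range' hr]
  rw [Finset.sum_comm]
  exact Finset.sum_congr rfl fun x _ => Finset.sum_comm

/-- The second difference of `m + 1`-st powers at the points `c (c - 1)`, `c (c + 1)` and
`(c + 1) (c + 2)` is a polynomial in `c (c + 1)`, because the two outer points have sum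
`2 u + 2` and product `u (u - 2)` for `u = c (c + 1)`. -/
theorem exists_eval_eq_second_difference (m : ℕ) : ∃ r : Polynomial ℚ, r.natDegree ≤ m ∧ ∀ c : ℕ,
    r.eval (hi c) = hi (c + 1) ^ (m + 1) + lo c ^ (m + 1) - 2 * hi c ^ (m + 1) := by
  have hsum (c : ℕ) : hi (c + 1) + lo c = 2 * hi c + 2 := by
    simp only [hi, lo]; push_cast; ring
  have hprod (c : ℕ) : hi (c + 1) * lo c = hi c * (hi c - 2) := by
    simp only [hi, lo]; push_cast; ring
  induction m using Nat.twoStepInduction with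
  | zero =>
    refine ⟨2, by simp, fun c => ?_⟩
    rw [Polynomial.eval_ofNat]
    linear_combination -hsum c
  | one =>
    refine ⟨12 * Polynomial.X + 4, by compute_degree, fun c => ?_⟩
    simp only [Polynomial.eval_add, Polynomial.eval_mul, Polynomial.eval_ofNat, Polynomial.eval_X]
    linear_combination (-(hi (c + 1) + lo c) - (2 * hi c + 2)) * hsum c + 2 * hprod c
  | more m ih1 ih2 =>
    obtain ⟨r, hr, hr'⟩ := ih1
    obtain ⟨s, hs, hs'⟩ := ih2
    refine ⟨(2 * Polynomial.X + 2) * s - Polynomial.X * (Polynomial.X - 2) * r +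
      8 * Polynomial.X ^ (m + 2), ?_, fun c => ?_⟩
    · refine Polynomial.natDegree_add_le_of_degree_le
        ((Polynomial.natDegree_sub_le_of_le (m := m + 2) (n := m + 2) ?_ ?_).trans_eq
          (max_self _)) ?_
      · have h : (2 * Polynomial.X + 2 : Polynomial ℚ).natDegree ≤ 1 := by compute_degree
        exact (Polynomial.natDegree_mul_le_of_le h hs).trans (by omega)
      · have h : (Polynomial.X * (Polynomial.X - 2) : Polynomial ℚ).natDegree ≤ 2 := by
          compute_degree
        exact (Polynomial.natDegree_mul_le_of_le h hr).trans (by omega)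
      · compute_degree
    · simp only [Polynomial.eval_add, Polynomial.eval_mul, Polynomial.eval_ofNat,
        Polynomial.eval_X, Polynomial.eval_sub, Polynomial.eval_pow, hr', hs']
      linear_combination (-hi (c + 1) ^ (m + 2) - lo c ^ (m + 2)) * hsum c +
        (hi (c + 1) ^ (m + 1) + lo c ^ (m + 1)) * hprod c

theorem filtered_sum_hi_pow_sub_lo_pow (m : ℕ) :
    Filtered (m + 1) fun S => ∑ x ∈ S, (hi x ^ (m + 1) - lo x ^ (m + 1)) := by
  obtain ⟨r, hr, hr'⟩ := exists_eval_eq_second_difference m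
  refine .congr (fun S _ => Finset.sum_congr rfl fun x _ => ?_)
    (filtered_sum_eval r (Nat.lt_succ_of_le hr))
  have h := Finset.sum_range_sub (fun c => hi c ^ (m + 1) - lo c ^ (m + 1)) x
  have h0 : hi 0 ^ (m + 1) - lo 0 ^ (m + 1) = 0 := by simp [hi, lo]
  rw [h0, sub_zero] at h
  rw [← h]
  refine Finset.sum_congr rfl fun c _ => ?_
  rw [hr', lo_succ]
  ring

theorem filtered_moment (k : ℕ) : Filtered k (moment k) := by
  induction k using Nat.strong_induction_on with
  | _ k ih =>
    cases k with
    | zero => exact .congr (fun S hS => by simp [moment, sum_upProb hS]) (.const 1)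
    | succ k =>
      refine .congr (fun S hS => ?_) (.const_mul (1 / ((k : ℚ) + 1))
        (.sum (Finset.HasAntidiagonal.antidiagonal k) fun m hm =>
          .mono ?_ (.mul (ih m.1 ?_) (filtered_sum_hi_pow_sub_lo_pow m.2))))
      · rw [← succ_mul_moment hS]
        field_simp
      all_goals
        have := Finset.HasAntidiagonal.mem_antidiagonal.1 hm
        omega

/-! ### Increments along the growth process -/

/-- Functions of a set of parts and a box to be appended to it that are polynomials in the value
of `c (c - 1)` at the content `c` of that box, with coefficients in the filtered algebra and with
total degree less than `d`. -/
inductive Increment (d : ℕ) : (Finset ℕ → ℕ → ℚ) → Prop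
  | zero : Increment d fun _ _ => 0
  | monomial {e k : ℕ} {f : Finset ℕ → ℚ} (hf : Filtered e f) (h : e + k + 1 ≤ d) :
      Increment d fun S x => f S * hi x ^ k
  | add {F G : Finset ℕ → ℕ → ℚ} (hF : Increment d F) (hG : Increment d G) :
      Increment d fun S x => F S x + G S x

theorem Increment.mono {d e : ℕ} {F : Finset ℕ → ℕ → ℚ} (hde : d ≤ e) (hF : Increment d F) :
    Increment e F := by
  induction hF with
  | zero => exact .zero
  | monomial hf h => exact .monomial hf (h.trans hde)
  | add _ _ ihF ihG => exact .add ihF ihG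

theorem Increment.monomial_mul {d e k : ℕ} {f : Finset ℕ → ℚ} {F : Finset ℕ → ℕ → ℚ}
    (hf : Filtered e f) (hF : Increment d F) :
    Increment (e + k + d) fun S x => f S * hi x ^ k * F S x := by
  induction hF with
  | zero => simpa using Increment.zero
  | @monomial e' k' f' hf' h =>
    have h1 := Increment.monomial (d := e + k + d) (k := k + k') (.mul hf hf') (by omega)
    refine cast (congrArg _ ?_) h1
    funext S x
    ring
  | add _ _ ihF ihG =>
    refine cast (congrArg _ ?_) (ihF.add ihG)
    funext S x
    ring

theorem Increment.mul {d e : ℕ} {F G : Finset ℕ → ℕ → ℚ} (hF : Increment d F)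
    (hG : Increment e G) : Increment (d + e) fun S x => F S x * G S x := by
  induction hF with
  | zero => simpa using Increment.zero
  | monomial hf h => exact (Increment.monomial_mul hf hG).mono (by omega)
  | add _ _ ihF ihG =>
    refine cast (congrArg _ ?_) (ihF.add ihG)
    funext S x
    ring

theorem Increment.filtered_mul {d e : ℕ} {f : Finset ℕ → ℚ} {F : Finset ℕ → ℕ → ℚ}
    (hf : Filtered e f) (hF : Increment d F) : Increment (e + d) fun S x => f S * F S x := by
  simpa using Increment.monomial_mul (k := 0) hf hF

/-- Appending a box changes a function in the filtered algebra by an increment of smaller total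
degree. -/
theorem Filtered.exists_increment {d : ℕ} {f : Finset ℕ → ℚ} (hf : Filtered d f) :
    ∃ F, Increment d F ∧ ∀ S : Finset ℕ, 0 ∉ S → ∀ x ∈ insert 0 S, x + 1 ∉ S →
      f (addBox S x) = f S + F S x := by
  induction hf with
  | const c => exact ⟨_, .zero (d := 0), fun S _ x _ _ => (add_zero c).symm⟩
  | contentSum d =>
    refine ⟨_, .monomial (d := d + 1) (k := d) (.const 1) (by omega), fun S hS x hx hx1 => ?_⟩
    rw [PartSet.contentSum, PartSet.contentSum,
      sum_addBox hS hx hx1 (fun x => ∑ c ∈ Finset.range x, hi c ^ d) rfl, Finset.sum_range_succ]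
    ring
  | add _ _ ihf ihg =>
    obtain ⟨F, hF, hF'⟩ := ihf
    obtain ⟨G, hG, hG'⟩ := ihg
    refine ⟨_, hF.add hG, fun S hS x hx hx1 => ?_⟩
    simp only [hF' S hS x hx hx1, hG' S hS x hx hx1]
    ring
  | @mul d e f g hf hg ihf ihg =>
    obtain ⟨F, hF, hF'⟩ := ihf
    obtain ⟨G, hG, hG'⟩ := ihg
    refine ⟨_, ((Increment.filtered_mul hf hG).add
      ((Increment.filtered_mul hg hF).mono (add_comm e d).le)).add (hF.mul hG),
      fun S hS x hx hx1 => ?_⟩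
    simp only [hF' S hS x hx hx1, hG' S hS x hx hx1]
    ring
  | mono hde _ ih =>
    obtain ⟨F, hF, hF'⟩ := ih
    exact ⟨F, hF.mono hde, hF'⟩
  | congr hfg _ ih =>
    obtain ⟨F, hF, hF'⟩ := ih
    refine ⟨F, hF, fun S hS x hx hx1 => ?_⟩
    rw [← hfg S hS, ← hfg _ (zero_notMem_addBox hS x), hF' S hS x hx hx1]

theorem Increment.eq_zero {F : Finset ℕ → ℕ → ℚ} (hF : Increment 0 F) (S : Finset ℕ) (x : ℕ) :
    F S x = 0 := by
  induction hF with
  | zero => rfl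
  | monomial _ h => omega
  | add _ _ ihF ihG => simp only [ihF, ihG, add_zero]

/-- The `k`-th power in an increment of total degree `d` is averaged to a moment of degree `k`. -/
theorem Increment.filtered_sum_upProb {d : ℕ} {F : Finset ℕ → ℕ → ℚ} (hF : Increment (d + 1) F) :
    Filtered d fun S => ∑ x ∈ insert 0 S, upProb S x * F S x := by
  induction hF with
  | zero => simpa using Filtered.mono (Nat.zero_le d) (.const 0)
  | @monomial e k f hf h =>
    refine .congr (fun S _ => ?_) (.mono (show e + k ≤ d by omega) (.mul hf (filtered_moment k)))
    rw [moment, Finset.mul_sum]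
    exact Finset.sum_congr rfl fun x _ => by ring
  | add _ _ ihF ihG =>
    refine .congr (fun S _ => ?_) (.add ihF ihG)
    rw [← Finset.sum_add_distrib]
    exact Finset.sum_congr rfl fun x _ => by ring

/-! ### Polynomiality of the means -/

/-- A function on the natural numbers with polynomial differences is a polynomial. -/
theorem exists_polynomial_of_succ_eq_add {f : ℕ → ℚ} {P : Polynomial ℚ}
    (hf : ∀ n : ℕ, f (n + 1) = f n + P.eval (n : ℚ)) :
    ∃ Q : Polynomial ℚ, ∀ n : ℕ, f n = Q.eval (n : ℚ) := by
  have hpow : ∀ k : ℕ, ∃ Q : Polynomial ℚ, ∀ n : ℕ,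
      ∑ i ∈ Finset.range n, (i : ℚ) ^ k = Q.eval (n : ℚ) := fun k =>
    ⟨∑ i ∈ Finset.range (k + 1), Polynomial.C (bernoulli i * ((k + 1).choose i) / (k + 1)) *
      Polynomial.X ^ (k + 1 - i), fun n => by
        rw [sum_range_pow, Polynomial.eval_finsetSum]
        refine Finset.sum_congr rfl fun i _ => ?_
        simp only [Polynomial.eval_mul, Polynomial.eval_C, Polynomial.eval_pow, Polynomial.eval_X]
        ring⟩
  choose R hR using hpow
  have hsum (n : ℕ) : f n = f 0 + ∑ i ∈ Finset.range n, P.eval (i : ℚ) := by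
    induction n with
    | zero => simp
    | succ n ih => rw [hf, ih, Finset.sum_range_succ, add_assoc]
  refine ⟨Polynomial.C (f 0) +
    ∑ k ∈ Finset.range (P.natDegree + 1), Polynomial.C (P.coeff k) * R k, fun n => ?_⟩
  rw [hsum, Polynomial.eval_add, Polynomial.eval_C, Polynomial.eval_finsetSum]
  simp_rw [Polynomial.eval_mul, Polynomial.eval_C, ← hR]
  simp only [Polynomial.eval_eq_sum_range (p := P), Finset.mul_sum]
  rw [Finset.sum_comm]

theorem mean_succ_of_increment {f : Finset ℕ → ℚ} {F : Finset ℕ → ℕ → ℚ}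
    (hF : ∀ S : Finset ℕ, 0 ∉ S → ∀ x ∈ insert 0 S, x + 1 ∉ S →
      f (addBox S x) = f S + F S x) (n : ℕ) :
    mean (n + 1) f = mean n f + mean n fun S => ∑ x ∈ insert 0 S, upProb S x * F S x := by
  rw [mean_succ, mean, mean, mean, ← mul_add, ← Finset.sum_add_distrib]
  congr 1
  refine Finset.sum_congr rfl fun S hS => ?_
  rw [mem_ofSize] at hS
  rw [← mul_add]
  congr 1
  have hfS : f S = ∑ x ∈ insert 0 S, upProb S x * f S := by
    rw [← Finset.sum_mul, sum_upProb hS.1, one_mul]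
  rw [hfS, ← Finset.sum_add_distrib]
  refine Finset.sum_congr rfl fun x hx => ?_
  by_cases hx1 : x + 1 ∈ S
  · simp [upProb_eq_zero hx1]
  · rw [hF S hS.1 x hx hx1, mul_add]

/-- The means of a function in the filtered algebra are polynomial in the size: the drift of the
growth process lowers the degree. -/
theorem Filtered.exists_mean_eq_eval {d : ℕ} {f : Finset ℕ → ℚ} (hf : Filtered d f) :
    ∃ P : Polynomial ℚ, ∀ n : ℕ, mean n f = P.eval (n : ℚ) := by
  induction d generalizing f with
  | zero =>
    obtain ⟨F, hF, hF'⟩ := hf.exists_increment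
    refine exists_polynomial_of_succ_eq_add (P := 0) fun n => ?_
    rw [mean_succ_of_increment hF']
    simp [hF.eq_zero, mean]
  | succ d ih =>
    obtain ⟨F, hF, hF'⟩ := hf.exists_increment
    obtain ⟨P, hP⟩ := ih hF.filtered_sum_upProb
    exact exists_polynomial_of_succ_eq_add (P := P) fun n => by
      rw [mean_succ_of_increment hF', hP]

end PartSet

/-! ### Hook lengths of the doubled distinct partition -/

/-- In row `i` of a diagram whose first `l` rows have the lengths `k + 1 + x k`, the hook lengths
of the boxes in the columns from `l` on, where `c j` is the length of the column `j`, together with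
the differences `x i - x k` for `k > i`, are the numbers `1, …, x i`. -/
theorem prod_hook_mul_prod_sub {l i : ℕ} {x c : ℕ → ℕ} (hi : i < l)
    (hx : ∀ a b, a < b → b < l → x b < x a) (hl : l ≤ i + 1 + x i) (hcl : ∀ j, l ≤ j → c j ≤ l)
    (hc : ∀ j, l ≤ j → ∀ k < l, (k < c j ↔ j ≤ k + x k)) :
    (∏ j ∈ Finset.Ico l (i + 1 + x i), (x i + c j - j)) *
      ∏ k ∈ Finset.Ico (i + 1) l, (x i - x k) = (x i)! := by
  have hlt : ∀ j ∈ Finset.Ico l (i + 1 + x i), l ≤ j ∧ j ≤ i + x i ∧ i < c j ∧ c j ≤ l := by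
    intro j hj
    rw [Finset.mem_Ico] at hj
    exact ⟨hj.1, by omega, (hc j hj.1 i hi).2 (by omega), hcl j hj.1⟩
  have hanti : ∀ j j', l ≤ j → j ≤ j' → c j' ≤ c j := by
    intro j j' hj hjj
    by_contra! h
    have h1 := (hc j' (hj.trans hjj) (c j) (h.trans_le (hcl j' (hj.trans hjj)))).1 h
    have h2 := (hc j hj (c j) (h.trans_le (hcl j' (hj.trans hjj)))).2 (by omega)
    exact lt_irrefl _ h2
  have hinj1 : Set.InjOn (fun j => x i + c j - j) (Finset.Ico l (i + 1 + x i)) := by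
    intro j hj j' hj' h
    have h1 := hlt j hj
    have h2 := hlt j' hj'
    simp only at h
    rcases le_total j j' with hle | hle
    · have := hanti j j' h1.1 hle
      omega
    · have := hanti j' j h2.1 hle
      omega
  have hinj2 : Set.InjOn (fun k => x i - x k) (Finset.Ico (i + 1) l) := by
    intro k hk k' hk' h
    rw [Finset.mem_coe, Finset.mem_Ico] at hk hk'
    have h1 := hx i k (by omega) hk.2
    have h2 := hx i k' (by omega) hk'.2
    simp only at h
    rcases lt_trichotomy k k' with hlt | heq | hlt
    · have := hx k k' hlt hk'.2
      omega
    · exact heq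
    · have := hx k' k hlt hk.2
      omega
  have hdisj : Disjoint ((Finset.Ico l (i + 1 + x i)).image fun j => x i + c j - j)
      ((Finset.Ico (i + 1) l).image fun k => x i - x k) := by
    rw [Finset.disjoint_left]
    intro y hy hy'
    obtain ⟨j, hj, rfl⟩ := Finset.mem_image.1 hy
    obtain ⟨k, hk, h⟩ := Finset.mem_image.1 hy'
    have h1 := hlt j hj
    rw [Finset.mem_Ico] at hk
    have h2 := hx i k (by omega) hk.2
    have h3 := hc j h1.1 k hk.2
    -- An equality means `j = x k + c j`, against `hc` both for `k < c j` and for `c j ≤ k`.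
    omega
  have hunion : ((Finset.Ico l (i + 1 + x i)).image fun j => x i + c j - j) ∪
      ((Finset.Ico (i + 1) l).image fun k => x i - x k) = Finset.Ico 1 (x i + 1) := by
    refine Finset.eq_of_subset_of_card_le (fun y hy => ?_) ?_
    · rw [Finset.mem_Ico]
      rcases Finset.mem_union.1 hy with hy | hy
      · obtain ⟨j, hj, rfl⟩ := Finset.mem_image.1 hy
        have h1 := hlt j hj
        omega
      · obtain ⟨k, hk, rfl⟩ := Finset.mem_image.1 hy
        rw [Finset.mem_Ico] at hk
        have h2 := hx i k (by omega) hk.2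
        omega
    · rw [Finset.card_union_of_disjoint hdisj, Finset.card_image_of_injOn hinj1,
        Finset.card_image_of_injOn hinj2, Nat.card_Ico, Nat.card_Ico, Nat.card_Ico]
      omega
  have hfac : ∏ y ∈ Finset.Ico 1 (x i + 1), y = (x i)! := by
    rw [Finset.prod_Ico_eq_prod_range, Nat.add_sub_cancel, ← Finset.prod_range_add_one_eq_factorial]
    exact Finset.prod_congr rfl fun y _ => add_comm 1 y
  rw [← hfac, ← hunion, Finset.prod_union hdisj, Finset.prod_image hinj1,
    Finset.prod_image hinj2]

/-- The product of a symmetric function over all pairs of indices, in terms of the pairs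
`i < j`. -/
theorem prod_range_prod_range_eq {M : Type*} [CommMonoid M] (k : ℕ → ℕ → M)
    (hsymm : ∀ i j, k i j = k j i) (hdiag : ∀ i, k i i = 1) (l : ℕ) :
    ∏ i ∈ Finset.range l, ∏ j ∈ Finset.range l, k i j =
      ∏ i ∈ Finset.range l, ∏ j ∈ Finset.Ico (i + 1) l, k i j ^ 2 := by
  induction l with
  | zero => simp
  | succ l ih =>
    have h1 : ∀ i ∈ Finset.range l, ∏ j ∈ Finset.Ico (i + 1) (l + 1), k i j ^ 2 =
        (∏ j ∈ Finset.Ico (i + 1) l, k i j ^ 2) * k i l ^ 2 := fun i hi =>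
      Finset.prod_Ico_succ_top (Finset.mem_range.1 hi) _
    rw [Finset.prod_range_succ fun i => ∏ j ∈ Finset.Ico (i + 1) (l + 1), k i j ^ 2,
      Finset.prod_congr rfl h1, Finset.prod_mul_distrib, ← ih]
    simp only [Finset.prod_range_succ, Finset.prod_mul_distrib, hdiag, Finset.Ico_self,
      Finset.prod_empty, mul_one, sq, mul_assoc, fun j => hsymm l j]

namespace StrictPartition

/-- The set of parts of a strict partition. -/
def partSet (p : StrictPartition) : Finset ℕ := p.parts.toFinset

theorem zero_notMem_partSet (p : StrictPartition) : 0 ∉ p.partSet := fun h =>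
  lt_irrefl 0 (p.pos 0 (List.mem_toFinset.1 h))

theorem part_pos (p : StrictPartition) {i : ℕ} (hi : i < p.length) : 0 < p.part i := by
  rw [part, List.getD_eq_getElem _ _ hi]
  exact p.pos _ (List.getElem_mem hi)

theorem part_eq_zero (p : StrictPartition) {i : ℕ} (hi : p.length ≤ i) : p.part i = 0 :=
  List.getD_eq_default _ _ hi

theorem part_lt_part (p : StrictPartition) (a b : ℕ) (hab : a < b) (hb : b < p.length) :
    p.part b < p.part a := by
  have := p.add_part_le hab.le (p.part_pos hb)
  omega

theorem length_le_add_part (p : StrictPartition) {i : ℕ} (hi : i < p.length) :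
    p.length ≤ i + p.part i := by
  have h1 := p.part_pos (i := p.length - 1) (by omega)
  have h2 := p.add_part_le (a := i) (b := p.length - 1) (by omega) h1
  omega

theorem part_injOn (p : StrictPartition) : Set.InjOn p.part (Finset.range p.length) := by
  intro a ha b hb h
  rw [Finset.mem_coe, Finset.mem_range] at ha hb
  rcases lt_trichotomy a b with hab | hab | hab
  · exact absurd h (p.part_lt_part a b hab hb).ne'
  · exact hab
  · exact absurd h (p.part_lt_part b a hab ha).ne

theorem partSet_eq_image (p : StrictPartition) :
    p.partSet = (Finset.range p.length).image p.part := by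
  ext x
  rw [partSet, List.mem_toFinset, Finset.mem_image, List.mem_iff_getElem]
  constructor
  · rintro ⟨i, hi, rfl⟩
    exact ⟨i, Finset.mem_range.2 hi, List.getD_eq_getElem _ _ hi⟩
  · rintro ⟨i, hi, rfl⟩
    exact ⟨i, Finset.mem_range.1 hi, (List.getD_eq_getElem _ _ (Finset.mem_range.1 hi)).symm⟩

@[to_additive]
theorem prod_partSet {M : Type*} [CommMonoid M] (p : StrictPartition) (f : ℕ → M) :
    ∏ x ∈ p.partSet, f x = ∏ i ∈ Finset.range p.length, f (p.part i) := by
  rw [partSet_eq_image, Finset.prod_image p.part_injOn]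

/-- The boxes of the doubled diagram, enumerated along the rows of the shifted diagram and along
the columns that are added to it. -/
@[to_additive]
theorem prod_doubled_cells {M : Type*} [CommMonoid M] (p : StrictPartition) (f : ℕ × ℕ → M) :
    ∏ c ∈ p.doubled.cells, f c = ∏ i ∈ Finset.range p.length,
      ((∏ k ∈ Finset.range (p.part i), f (i, i + 1 + k)) *
        ∏ k ∈ Finset.range (p.part i), f (i + k, i)) := by
  have hdisj : Disjoint p.shiftedCells p.addedCells := by
    rw [Finset.disjoint_left]
    rintro ⟨i, j⟩ h1 h2
    simp only [shiftedCells, addedCells, Finset.mem_biUnion, Finset.mem_range, Finset.mem_image,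
      Prod.mk.injEq] at h1 h2
    obtain ⟨a, _, k, hk, rfl, rfl⟩ := h1
    obtain ⟨b, _, k', hk', h3, h4⟩ := h2
    omega
  change ∏ c ∈ p.shiftedCells ∪ p.addedCells, f c = _
  rw [Finset.prod_union hdisj, shiftedCells, addedCells, Finset.prod_biUnion, Finset.prod_biUnion,
    ← Finset.prod_mul_distrib]
  · refine Finset.prod_congr rfl fun i _ => ?_
    rw [Finset.prod_image fun a _ b _ h => by simpa using h,
      Finset.prod_image fun a _ b _ h => by simpa using h]
  · intro a _ b _ hab
    rw [Function.onFun, Finset.disjoint_left]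
    intro c h1 h2
    obtain ⟨k, _, rfl⟩ := Finset.mem_image.1 h1
    obtain ⟨k', _, h⟩ := Finset.mem_image.1 h2
    exact hab (Prod.mk.inj h).2.symm
  · intro a _ b _ hab
    rw [Function.onFun, Finset.disjoint_left]
    intro c h1 h2
    obtain ⟨k, _, rfl⟩ := Finset.mem_image.1 h1
    obtain ⟨k', _, h⟩ := Finset.mem_image.1 h2
    exact hab (Prod.mk.inj h).1.symm

theorem card_doubled (p : StrictPartition) : p.doubled.card = 2 * ∑ x ∈ p.partSet, x := by
  rw [YoungDiagram.card, Finset.card_eq_sum_ones, sum_doubled_cells, sum_partSet, Finset.mul_sum]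
  refine Finset.sum_congr rfl fun i _ => ?_
  rw [← Finset.card_eq_sum_ones, Finset.card_range]
  ring

theorem mem_doubled (p : StrictPartition) {i j : ℕ} : (i, j) ∈ p.doubled ↔
    (i < j ∧ j ≤ i + p.part i) ∨ (j ≤ i ∧ i < j + p.part j) :=
  p.mem_union i j

theorem rowLen_doubled (p : StrictPartition) {i : ℕ} (hi : i < p.length) :
    p.doubled.rowLen i = i + 1 + p.part i := by
  refine eq_of_forall_lt_iff fun j => ?_
  rw [← YoungDiagram.mem_iff_lt_rowLen, mem_doubled]
  have h := p.length_le_add_part hi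
  have h' : j < p.length → p.length ≤ j + p.part j := p.length_le_add_part
  omega

theorem colLen_doubled (p : StrictPartition) {j : ℕ} (hj : j < p.length) :
    p.doubled.colLen j = j + p.part j := by
  refine eq_of_forall_lt_iff fun i => ?_
  rw [← YoungDiagram.mem_iff_lt_colLen, mem_doubled]
  have h := p.length_le_add_part hj
  have h' : i < p.length → p.length ≤ i + p.part i := p.length_le_add_part
  omega

theorem hookLen_doubled_square (p : StrictPartition) {i j : ℕ} (hi : i < p.length)
    (hj : j < p.length) : p.doubled.hookLen i j = p.part i + p.part j := by
  rw [YoungDiagram.hookLen, p.rowLen_doubled hi, p.colLen_doubled hj]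
  have h1 := p.length_le_add_part hi
  have h2 := p.length_le_add_part hj
  omega

/-- The hook lengths in row `i` to the right of the diagonal square of size `p.length`. -/
theorem prod_hookLen_row (p : StrictPartition) {i : ℕ} (hi : i < p.length) :
    (∏ j ∈ Finset.Ico p.length (i + 1 + p.part i), p.doubled.hookLen i j) *
      ∏ k ∈ Finset.Ico (i + 1) p.length, (p.part i - p.part k) = (p.part i)! := by
  have hmem : ∀ j, p.length ≤ j → ∀ k, (k < p.doubled.colLen j ↔ k < j ∧ j ≤ k + p.part k) := by
    intro j hj k
    rw [← YoungDiagram.mem_iff_lt_colLen, mem_doubled, p.part_eq_zero hj]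
    omega
  rw [← prod_hook_mul_prod_sub (c := p.doubled.colLen) hi p.part_lt_part
    ((p.length_le_add_part hi).trans (by omega))]
  · congr 1
    refine Finset.prod_congr rfl fun j hj => ?_
    rw [Finset.mem_Ico] at hj
    have := (hmem j hj.1 i).2 (by omega)
    rw [YoungDiagram.hookLen, p.rowLen_doubled hi]
    omega
  · intro j hj
    by_contra! h
    have h1 := (hmem j hj p.length).1 h
    rw [p.part_eq_zero le_rfl] at h1
    omega
  · intro j hj k hk
    rw [hmem j hj k]
    omega

/-- The hook lengths in column `j` below the diagonal square of size `p.length`. -/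
theorem prod_hookLen_col (p : StrictPartition) {j : ℕ} (hj : j < p.length) :
    (∏ i ∈ Finset.Ico p.length (j + p.part j), p.doubled.hookLen i j) *
      ∏ k ∈ Finset.Ico (j + 1) p.length, (p.part j - p.part k) = (p.part j - 1)! := by
  have hmem : ∀ i, p.length ≤ i → ∀ k, (k < p.doubled.rowLen i ↔ k ≤ i ∧ i < k + p.part k) := by
    intro i hi k
    rw [← YoungDiagram.mem_iff_lt_rowLen, mem_doubled, p.part_eq_zero hi]
    omega
  have hpos := p.part_pos hj
  have hlen := p.length_le_add_part hj
  rw [← prod_hook_mul_prod_sub (x := fun k => p.part k - 1) (c := p.doubled.rowLen) hj]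
  · have hj1 : j + 1 + (p.part j - 1) = j + p.part j := by omega
    rw [hj1]
    congr 1
    · refine Finset.prod_congr rfl fun i hi => ?_
      rw [Finset.mem_Ico] at hi
      have := (hmem i hi.1 j).2 (by omega)
      rw [YoungDiagram.hookLen, p.colLen_doubled hj]
      omega
    · refine Finset.prod_congr rfl fun k hk => ?_
      have := p.part_pos (Finset.mem_Ico.1 hk).2
      omega
  · intro a b hab hb
    have h1 := p.part_lt_part a b hab hb
    have h2 := p.part_pos hb
    omega
  · omega
  · intro i hi
    by_contra! h
    have h1 := (hmem i hi p.length).1 h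
    rw [p.part_eq_zero le_rfl] at h1
    omega
  · intro i hi k hk
    have := p.part_pos hk
    rw [hmem i hi k]
    omega

theorem hookProd_doubled (p : StrictPartition) : p.doubled.hookProd =
    ∏ i ∈ Finset.range p.length,
      ((∏ j ∈ Finset.Ico p.length (i + 1 + p.part i), p.doubled.hookLen i j) *
        (∏ r ∈ Finset.Ico p.length (i + p.part i), p.doubled.hookLen r i) *
        (2 * p.part i * ∏ j ∈ Finset.Ico (i + 1) p.length, (p.part i + p.part j) ^ 2)) := by
  rw [YoungDiagram.hookProd, prod_doubled_cells]
  refine Finset.prod_congr rfl fun i hi => ?_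
  rw [Finset.mem_range] at hi
  have hlen := p.length_le_add_part hi
  have hrow : ∏ k ∈ Finset.range (p.part i), p.doubled.hookLen i (i + 1 + k) =
      (∏ j ∈ Finset.Ico (i + 1) p.length, (p.part i + p.part j)) *
        ∏ j ∈ Finset.Ico p.length (i + 1 + p.part i), p.doubled.hookLen i j := by
    have h := Finset.prod_Ico_eq_prod_range (p.doubled.hookLen i) (i + 1) (i + 1 + p.part i)
    rw [Nat.add_sub_cancel_left] at h
    rw [← h, ← Finset.prod_Ico_consecutive _ (show i + 1 ≤ p.length from hi) (by omega)]
    congr 1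
    exact Finset.prod_congr rfl fun j hj => p.hookLen_doubled_square hi (Finset.mem_Ico.1 hj).2
  have hcol : ∏ k ∈ Finset.range (p.part i), p.doubled.hookLen (i + k) i =
      (2 * p.part i * ∏ j ∈ Finset.Ico (i + 1) p.length, (p.part i + p.part j)) *
        ∏ r ∈ Finset.Ico p.length (i + p.part i), p.doubled.hookLen r i := by
    have h := Finset.prod_Ico_eq_prod_range (fun r => p.doubled.hookLen r i) i (i + p.part i)
    rw [Nat.add_sub_cancel_left] at h
    rw [← h, ← Finset.prod_Ico_consecutive _ hi.le hlen, Finset.prod_eq_prod_Ico_succ_bot hi,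
      p.hookLen_doubled_square hi hi, ← two_mul]
    congr 2
    exact Finset.prod_congr rfl fun j hj => by
      rw [p.hookLen_doubled_square (Finset.mem_Ico.1 hj).2 hi, add_comm]
  rw [hrow, hcol, Finset.prod_pow]
  ring

theorem one_div_hookProd_doubled (p : StrictPartition) :
    1 / (p.doubled.hookProd : ℚ) = PartSet.weight p.partSet := by
  rw [PartSet.weight, prod_partSet, prod_partSet]
  simp only [prod_partSet]
  rw [prod_range_prod_range_eq (fun i j => PartSet.pairFactor (p.part i) (p.part j))
    (fun i j => PartSet.pairFactor_comm _ _) (fun i => if_pos rfl), ← Finset.prod_mul_distrib,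
    hookProd_doubled, Nat.cast_prod, one_div, ← Finset.prod_inv_distrib]
  refine Finset.prod_congr rfl fun i hi => ?_
  rw [Finset.mem_range] at hi
  obtain ⟨y, hy⟩ := Nat.exists_eq_succ_of_ne_zero (p.part_pos hi).ne'
  have hrow := congrArg (Nat.cast (R := ℚ)) (p.prod_hookLen_row hi)
  have hcol := congrArg (Nat.cast (R := ℚ)) (p.prod_hookLen_col hi)
  have hpair : ∏ j ∈ Finset.Ico (i + 1) p.length, PartSet.pairFactor (p.part i) (p.part j) ^ 2 =
      ((∏ j ∈ Finset.Ico (i + 1) p.length, (p.part i - p.part j) : ℕ) : ℚ) ^ 2 /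
        ((∏ j ∈ Finset.Ico (i + 1) p.length, (p.part i + p.part j) ^ 2 : ℕ) : ℚ) := by
    rw [Nat.cast_prod, Nat.cast_prod, ← Finset.prod_pow, ← Finset.prod_div_distrib]
    refine Finset.prod_congr rfl fun j hj => ?_
    rw [Finset.mem_Ico] at hj
    have hlt := p.part_lt_part i j (by omega) hj.2
    rw [PartSet.pairFactor_sq hlt.ne, Nat.cast_sub hlt.le, div_pow]
    push_cast
    ring
  have hD : ((∏ j ∈ Finset.Ico (i + 1) p.length, (p.part i - p.part j) : ℕ) : ℚ) ≠ 0 := by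
    rw [Nat.cast_ne_zero, Finset.prod_ne_zero_iff]
    intro j hj
    rw [Finset.mem_Ico] at hj
    have hlt := p.part_lt_part i j (by omega) hj.2
    omega
  have hA : ((∏ j ∈ Finset.Ico (i + 1) p.length, (p.part i + p.part j) ^ 2 : ℕ) : ℚ) ≠ 0 := by
    rw [Nat.cast_ne_zero, Finset.prod_ne_zero_iff]
    intro j _
    have := p.part_pos hi
    positivity
  rw [Nat.cast_mul] at hrow hcol
  have hrow' := eq_div_of_mul_eq hD hrow
  have hcol' := eq_div_of_mul_eq hD hcol
  rw [hpair, Nat.cast_mul, Nat.cast_mul, Nat.cast_mul, hrow', hcol', hy, Nat.succ_sub_one,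
    Nat.factorial_succ]
  rw [hy] at hD hA
  have hf : (y ! : ℚ) ≠ 0 := by exact_mod_cast Nat.factorial_ne_zero y
  have hy1 : ((y : ℚ) + 1) ≠ 0 := by positivity
  push_cast at hD hA ⊢
  field_simp

/-! ### Contents of the doubled distinct partition -/

theorem psiPow_contents (p : StrictPartition) (k : ℕ) :
    psiPow k (p.doubled.contents.map fun c : ℤ => (c : ℚ)) 0 =
      ∑ x ∈ p.partSet, ∑ c ∈ Finset.range x, (((c : ℚ) + 1) ^ k + (-(c : ℚ)) ^ k) := by
  have h : psiPow k (p.doubled.contents.map fun c : ℤ => (c : ℚ)) 0 =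
      ∑ c ∈ p.doubled.cells, ((c.2 : ℚ) - c.1) ^ k := by
    simp only [psiPow, YoungDiagram.contents, Multiset.map_map, Finset.sum_eq_multiset_sum]
    simp
  rw [h, sum_doubled_cells, sum_partSet]
  refine Finset.sum_congr rfl fun i _ => ?_
  rw [← Finset.sum_add_distrib]
  refine Finset.sum_congr rfl fun c _ => ?_
  push_cast
  ring

theorem partSet_injective : Function.Injective partSet := by
  intro p q h
  apply StrictPartition.ext'
  have hp : p.parts.Nodup := p.sorted.pairwise.imp fun h => ne_of_gt h
  have hq : q.parts.Nodup := q.sorted.pairwise.imp fun h => ne_of_gt h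
  exact List.Perm.eq_of_pairwise (fun a b _ _ h1 h2 => absurd h1 (lt_asymm h2))
    p.sorted.pairwise q.sorted.pairwise (List.perm_of_nodup_nodup_toFinset_eq hp hq h)

theorem sum_withDoubledSize (n : ℕ) (F : Finset ℕ → ℚ) :
    ∑ p ∈ withDoubledSize (2 * n), F p.partSet = ∑ S ∈ PartSet.ofSize n, F S := by
  refine Finset.sum_bij (fun p _ => p.partSet) (fun p hp => ?_)
    (fun p _ q _ h => partSet_injective h) (fun S hS => ?_) fun _ _ => rfl
  · rw [mem_withDoubledSize, card_doubled] at hp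
    exact PartSet.mem_ofSize.2 ⟨p.zero_notMem_partSet, by omega⟩
  · rw [PartSet.mem_ofSize] at hS
    have hpos : ∀ x ∈ S.sort (· ≥ ·), 0 < x := fun x hx =>
      Nat.pos_of_ne_zero fun h => hS.1 (h ▸ (Finset.mem_sort _).1 hx)
    have hset : partSet ⟨S.sort (· ≥ ·), Finset.sortedGT_sort S, hpos⟩ = S :=
      Finset.sort_toFinset ..
    refine ⟨_, ?_, hset⟩
    rw [mem_withDoubledSize, card_doubled, hset, hS.2]

end StrictPartition

namespace PartSet

/-- The numbers `c + 1` and `-c` have sum `1` and product `-c (c + 1)`. -/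
theorem exists_eval_hi_eq_add_pow (k : ℕ) : ∃ r : Polynomial ℚ, ∀ c : ℕ,
    r.eval (hi c) = ((c : ℚ) + 1) ^ k + (-(c : ℚ)) ^ k := by
  induction k using Nat.twoStepInduction with
  | zero => exact ⟨2, fun c => by rw [Polynomial.eval_ofNat]; norm_num⟩
  | one => exact ⟨1, fun c => by rw [Polynomial.eval_one]; ring⟩
  | more k ih1 ih2 =>
    obtain ⟨r, hr⟩ := ih1
    obtain ⟨s, hs⟩ := ih2
    refine ⟨s + Polynomial.X * r, fun c => ?_⟩
    rw [Polynomial.eval_add, Polynomial.eval_mul, Polynomial.eval_X, hr, hs, hi]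
    ring

theorem exists_filtered_prod_contents (s : Multiset ℕ) : ∃ d, Filtered d fun S =>
    (s.map fun k => ∑ x ∈ S, ∑ c ∈ Finset.range x, (((c : ℚ) + 1) ^ k + (-(c : ℚ)) ^ k)).prod := by
  induction s using Multiset.induction_on with
  | empty => exact ⟨0, by simpa using Filtered.const 1⟩
  | cons k s ih =>
    obtain ⟨d, hd⟩ := ih
    obtain ⟨r, hr⟩ := exists_eval_hi_eq_add_pow k
    have h := filtered_sum_eval r (Nat.lt_succ_self _)
    simp only [hr] at h
    exact ⟨_, .congr (fun S _ => by rw [Multiset.map_cons, Multiset.prod_cons]) (h.mul hd)⟩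

end PartSet

theorem mainTheorem8 {m : ℕ} (δ : Nat.Partition m) :
    ∃ P : Polynomial ℚ, ∀ n : ℕ,
      2 ^ n * (n ! : ℚ) *
          ∑ p ∈ StrictPartition.withDoubledSize (2 * n),
            1 / (p.doubled.hookProd : ℚ) *
              psiPartition δ (p.doubled.contents.map fun c : ℤ => (c : ℚ)) 0
        = P.eval (n : ℚ) := by
  obtain ⟨d, hd⟩ := PartSet.exists_filtered_prod_contents δ.parts
  obtain ⟨P, hP⟩ := hd.exists_mean_eq_eval
  refine ⟨P, fun n => ?_⟩
  rw [← hP, PartSet.mean, ← StrictPartition.sum_withDoubledSize]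
  congr 1
  refine Finset.sum_congr rfl fun p _ => ?_
  simp only [psiPartition, StrictPartition.one_div_hookProd_doubled,
    StrictPartition.psiPow_contents]
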